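/- Conventions. A subset $S$ of a group $G$ is called \emph{regular} if there are a finite alphabet $X$, a surjective monoid homomorphism $\pi\colon X^*\to G$ and a regular language $\mathcal L\subseteq X^*$ (one accepted by a finite state automaton) with $\pi(\mathcal L)=S$. For a subgroup $H\le G$, a \emph{positive cone of $G$ relative to $H$} is a (possibly empty) subset $P\subseteq G$ with $PP\subseteq P$ such that $G$ is the disjoint union $P\sqcup H\sqcup P^{-1}$; a \emph{positive cone} of $G$ is a positive cone relative to $\{1\}$. A \emph{left-order} on $G$ is a strict total order $\prec$ on $G$ such that $a\prec b\Leftrightarrow ca\prec cb$ for all $a,b,c\in G$; it is \emph{regular} if $\{g\in G: 1\prec g\}$ is a regular subset of $G$. Theorem. Let $G_1,\dots,G_n$ be finitely generated groups with a common subgroup $C$ (that is, $C$ is a group with a given injective homomorphism $C\hookrightarrow G_i$ for each $i$). Suppose that each $G_i$ admits a regular positive cone relative to (the image of) $C$, and that $C$ admits a regular positive cone. Let $G=G_1*_C\cdots*_C G_n$ be the free product of the $G_i$ amalgamated over $C$. Then $G\times\mathbb Z$ admits a regular left-order. -/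

import Mathlib

namespace RegularOrder

universe u

variable {G : Type u} [Group G]

/-- A subset `S` of `G` is the evaluation of a regular language: there are a finite alphabet `X`, a
surjective monoid homomorphism `π : X* → G` (a finite monoid generating set of `G`) and a regular
language `L ⊆ X*` with `π(L) = S`. -/
def IsRegularSubset (S : Set G) : Prop :=
  ∃ (X : Type) (_ : Finite X) (π : FreeMonoid X →* G) (L : Language X),
    Function.Surjective π ∧ L.IsRegular ∧ {g : G | ∃ w ∈ L, π (FreeMonoid.ofList w) = g} = S

/-- `P` is a positive cone relative to the subgroup `H`: `P` is a subsemigroup and `G` is the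
disjoint union of `P`, `H` and `P⁻¹`. -/
structure IsRelPositiveCone (P : Set G) (H : Subgroup G) : Prop where
  mul_mem : ∀ g ∈ P, ∀ h ∈ P, g * h ∈ P
  cover : ∀ g : G, g ∈ P ∨ g ∈ H ∨ g⁻¹ ∈ P
  disjoint_subgroup : ∀ g ∈ P, g ∉ H
  disjoint_inv : ∀ g ∈ P, g⁻¹ ∉ P

/-- `P` is a positive cone of `G`: `P` is a subsemigroup and `G` is the disjoint union of `P`,
`{1}` and `P⁻¹`. -/
structure IsPositiveCone (P : Set G) : Prop where
  mul_mem : ∀ g ∈ P, ∀ h ∈ P, g * h ∈ P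
  cover : ∀ g : G, g ∈ P ∨ g = 1 ∨ g⁻¹ ∈ P
  one_notMem : (1 : G) ∉ P
  disjoint_inv : ∀ g ∈ P, g⁻¹ ∉ P

/-- `r` is a (strict) left-order on `G`: a strict total order invariant under left
multiplication. -/
structure IsLeftOrder (r : G → G → Prop) : Prop where
  isStrictTotalOrder : IsStrictTotalOrder G r
  mul_left_iff : ∀ a b c : G, r a b ↔ r (c * a) (c * b)

variable (G) in
/-- `G` admits a regular positive cone. -/
def HasRegularPositiveCone : Prop :=
  ∃ P : Set G, IsPositiveCone P ∧ IsRegularSubset P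

/-- `G` admits a regular positive cone relative to `H`. -/
def HasRegularRelPositiveCone (H : Subgroup G) : Prop :=
  ∃ P : Set G, IsRelPositiveCone P H ∧ IsRegularSubset P

variable (G) in
/-- `G` admits a regular left-order: a left-order whose set of positive elements is the evaluation
of a regular language. -/
def HasRegularLeftOrder : Prop :=
  ∃ r : G → G → Prop, IsLeftOrder r ∧ IsRegularSubset {g : G | r 1 g}

end RegularOrder

/-! Give each letter of a reduced word the sign +1 or -1 according to its relative cone, and each
turn between consecutive factors a sign from a linear order on the index set. The sum of all these
signs is the weight `w`. It is a quasimorphism of defect at most 1 (`IsSignSystem.exists_merge`):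
cancellation removes letters of opposite signs, and only the place where it stops contributes an
error. On nonempty reduced words `w` is odd. The cone consists of the `(g, m)` with `2m + w(g) > 0`,
together with the positive elements of `C` at `m = 0`. The defect 1 makes it a semigroup, and the
parity makes it total (`IsSignSystem.isPositiveCone_weightCone`). For regularity, a letter sign plus
the following turn sign is even, so half of it can be recorded in the central factor; only the last
letter remains, and its sign sets the threshold for `m`. A finite automaton with states (factor,
sign) and rational transition sets therefore produces the cone (`linearSolution_weight_iff`).
Kleene's theorem translates between such sets and regular languages. -/

namespace Language

/-! ### Closure properties of regular languages -/

variable {α : Type*} {L L₁ L₂ : Language α}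

open scoped Computability

/-- The product of two regular languages is regular. -/
theorem IsRegular.mul (h₁ : L₁.IsRegular) (h₂ : L₂.IsRegular) : (L₁ * L₂).IsRegular := by
  refine .of_finite_range_leftQuotient ?_
  have hf₁ := h₁.finite_range_leftQuotient
  have hf₂ := h₂.finite_range_leftQuotient
  -- The quotient by `x` depends only on one quotient of `L₁` (when `x` ends inside the first
  -- factor) and on a set of quotients of `L₂` (when it ends inside the second): finitely many
  -- choices.
  refine ((hf₁.prod hf₂.powerset).image fun p => p.1 * L₂ + sSup p.2).subset ?_
  rintro _ ⟨x, rfl⟩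
  refine ⟨⟨L₁.leftQuotient x, {M | ∃ u v, u ++ v = x ∧ u ∈ L₁ ∧ M = L₂.leftQuotient v}⟩,
    ⟨⟨x, rfl⟩, ?_⟩, ?_⟩
  · rintro _ ⟨u, v, -, -, rfl⟩
    exact ⟨v, rfl⟩
  · ext w
    simp only [mem_add, mem_mul, mem_leftQuotient, sSup_eq_iSup, mem_iSup, Set.mem_ofPred_eq,
      exists_prop]
    constructor
    · rintro (⟨a, ha, b, hb, rfl⟩ | ⟨_, ⟨u, v, rfl, hu, rfl⟩, hw⟩)
      · exact ⟨x ++ a, ha, b, hb, by simp⟩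
      · exact ⟨u, hu, v ++ w, hw, by simp⟩
    · rintro ⟨a, ha, b, hb, h⟩
      rcases List.append_eq_append_iff.1 h with ⟨c, rfl, rfl⟩ | ⟨c, rfl, rfl⟩
      · exact .inr ⟨_, ⟨a, c, rfl, ha, rfl⟩, hb⟩
      · exact .inl ⟨c, ha, b, hb, rfl⟩

/-- Look at the block of the factorization that straddles the cut between `x` and `w`. This
describes the quotients of the star through those of `L`. -/
theorem append_mem_kstar_iff {x w : List α} :
    x ++ w ∈ L∗ ↔ (x ∈ L∗ ∧ w = []) ∨ ∃ u v, u ++ v = x ∧ u ∈ L∗ ∧ w ∈ L.leftQuotient v * L∗ := by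
  have append_mem : ∀ {a b : List α}, a ∈ L∗ → b ∈ L∗ → a ++ b ∈ L∗ := by
    intro a b ha hb
    rw [← kstar_mul_kstar]
    exact append_mem_mul ha hb
  have subset_kstar : ∀ {a : List α}, a ∈ L → a ∈ L∗ := fun {a} ha =>
    mem_kstar.2 ⟨[a], by simp, by simpa using ha⟩
  constructor
  · rw [mem_kstar]
    rintro ⟨M, hM, hL⟩
    induction M generalizing x w with
    | nil =>
      obtain ⟨rfl, rfl⟩ : x = [] ∧ w = [] := by simpa using hM
      exact .inl ⟨nil_mem_kstar _, rfl⟩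
    | cons y M ih =>
      have hy := hL y (by simp)
      have hM' : ∀ z ∈ M, z ∈ L := fun z hz => hL z (by simp [hz])
      rw [List.flatten_cons] at hM
      rcases List.append_eq_append_iff.1 hM with ⟨c, rfl, rfl⟩ | ⟨c, rfl, h⟩
      · exact .inr ⟨[], x, rfl, nil_mem_kstar _, mem_mul.2 ⟨c, hy, _, join_mem_kstar hM', rfl⟩⟩
      · rcases ih h.symm hM' with ⟨hc, rfl⟩ | ⟨u, v, rfl, hu, hw⟩
        · exact .inl ⟨append_mem (subset_kstar hy) hc, rfl⟩
        · exact .inr ⟨y ++ u, v, by simp, append_mem (subset_kstar hy) hu, hw⟩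
  · rintro (⟨hx, rfl⟩ | ⟨u, v, rfl, hu, hw⟩)
    · simpa using hx
    · obtain ⟨a, ha, b, hb, rfl⟩ := mem_mul.1 hw
      have := append_mem hu (append_mem (subset_kstar ha) hb)
      simpa using this

/-- The Kleene star of a regular language is regular. -/
theorem IsRegular.kstar (h : L.IsRegular) : (L∗).IsRegular := by
  refine .of_finite_range_leftQuotient ?_
  have hf := h.finite_range_leftQuotient
  have hE : ({0, 1} : Set (Language α)).Finite := by simp
  refine ((hE.prod hf.powerset).image fun p => p.1 + sSup p.2 * L∗).subset ?_
  rintro _ ⟨x, rfl⟩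
  classical
  refine ⟨⟨if x ∈ L∗ then 1 else 0, {M | ∃ u v, u ++ v = x ∧ u ∈ L∗ ∧ M = L.leftQuotient v}⟩,
    ⟨by dsimp only; split_ifs <;> simp, ?_⟩, ?_⟩
  · rintro _ ⟨u, v, -, -, rfl⟩
    exact ⟨v, rfl⟩
  · ext w
    rw [mem_leftQuotient, append_mem_kstar_iff, mem_add]
    refine or_congr ?_ ?_
    · dsimp only
      split_ifs with hx
      · simp [hx, mem_one]
      · simp [hx, notMem_zero]
    · simp only [mem_mul, sSup_eq_iSup, mem_iSup, Set.mem_ofPred_eq, exists_prop]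
      constructor
      · rintro ⟨_, ⟨_, ⟨u, v, rfl, hu, rfl⟩, ha⟩, b, hb, rfl⟩
        exact ⟨u, v, rfl, hu, _, ha, b, hb, rfl⟩
      · rintro ⟨u, v, rfl, hu, a, ha, b, hb, rfl⟩
        exact ⟨a, ⟨_, ⟨u, v, rfl, hu, rfl⟩, ha⟩, b, hb, rfl⟩

/-- A language consisting of a single word is regular. -/
theorem isRegular_singleton (w : List α) : IsRegular ({w} : Set (List α)) := by
  refine .of_finite_range_leftQuotient ?_
  have hf : {v | v <:+ w}.Finite :=
    w.tails.finite_toSet.subset fun v hv => (List.mem_tails _ _).2 hv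
  refine hf.powerset.subset ?_
  rintro _ ⟨x, rfl⟩ v hv
  exact ⟨x, hv⟩

theorem isRegular_zero : (0 : Language α).IsRegular := by
  refine .of_finite_range_leftQuotient ((Set.finite_singleton 0).subset ?_)
  rintro _ ⟨x, rfl⟩
  exact Set.mem_singleton_iff.2 (ext fun w => Iff.rfl)

end Language

/-! ### Rational subsets and Kleene's theorem -/

namespace RegularOrder

open scoped Pointwise

/-- The rational subsets of a monoid. -/
inductive IsRational {M : Type*} [Monoid M] : Set M → Prop
  | empty : IsRational ∅
  | singleton (a : M) : IsRational {a}
  | union {S T : Set M} : IsRational S → IsRational T → IsRational (S ∪ T)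
  | mul {S T : Set M} : IsRational S → IsRational T → IsRational (S * T)
  | closure {S : Set M} : IsRational S → IsRational (Submonoid.closure S : Set M)

namespace IsRational

theorem iUnion {M ι : Type*} [Monoid M] [Finite ι] {S : ι → Set M}
    (h : ∀ i, IsRational (S i)) : IsRational (⋃ i, S i) := by
  suffices ∀ t : Set ι, t.Finite → IsRational (⋃ i ∈ t, S i) by
    simpa using this _ Set.finite_univ
  intro t ht
  induction t, ht using Set.Finite.induction_on with
  | empty => simpa using empty
  | insert _ _ ih =>
    rw [Set.biUnion_insert]
    exact (h _).union ih

theorem of_finite {M : Type*} [Monoid M] {S : Set M} (h : S.Finite) : IsRational S := by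
  have := h.to_subtype
  rw [← Set.iUnion_of_singleton_coe S]
  exact iUnion fun i => singleton _

theorem image {M N : Type*} [Monoid M] [Monoid N] {S : Set M} (h : IsRational S) (f : M →* N) :
    IsRational (f '' S) := by
  induction h with
  | empty => simpa using empty
  | singleton a => simpa using singleton (f a)
  | union _ _ hS hT => simpa [Set.image_union] using hS.union hT
  | mul _ _ hS hT => simpa [Set.image_mul] using hS.mul hT
  | @closure S _ hS =>
    rw [← Submonoid.coe_map, MonoidHom.map_mclosure]
    exact hS.closure

theorem inv {G : Type*} [Group G] {S : Set G} (h : IsRational S) : IsRational S⁻¹ := by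
  induction h with
  | empty => simpa using empty
  | singleton a => simpa using singleton a⁻¹
  | union _ _ hS hT => simpa using hS.union hT
  | mul _ _ hS hT => simpa using hT.mul hS
  | @closure S _ hS =>
    rw [← Submonoid.coe_inv, ← Submonoid.closure_inv]
    exact hS.closure

/-- A rational set is contained in a finitely generated submonoid. -/
theorem exists_finite_subset_closure {M : Type*} [Monoid M] {S : Set M} (h : IsRational S) :
    ∃ T : Set M, T.Finite ∧ S ⊆ Submonoid.closure T := by
  have mono {T U : Set M} (h : T ⊆ U) := SetLike.coe_subset_coe.2 (Submonoid.closure_mono h)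
  induction h with
  | empty => exact ⟨∅, Set.finite_empty, Set.empty_subset _⟩
  | singleton a => exact ⟨{a}, Set.finite_singleton a, Submonoid.subset_closure⟩
  | union _ _ hS hT =>
    obtain ⟨T, hTf, hST⟩ := hS
    obtain ⟨U, hUf, hSU⟩ := hT
    exact ⟨T ∪ U, hTf.union hUf, Set.union_subset (hST.trans (mono Set.subset_union_left))
      (hSU.trans (mono Set.subset_union_right))⟩
  | mul _ _ hS hT =>
    obtain ⟨T, hTf, hST⟩ := hS
    obtain ⟨U, hUf, hSU⟩ := hT
    refine ⟨T ∪ U, hTf.union hUf, ?_⟩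
    rintro _ ⟨a, ha, b, hb, rfl⟩
    exact mul_mem (mono Set.subset_union_left (hST ha)) (mono Set.subset_union_right (hSU hb))
  | closure _ hS =>
    obtain ⟨T, hT, hST⟩ := hS
    exact ⟨T, hT, Submonoid.closure_le.2 hST⟩

/-- Every rational set is the evaluation of a regular language over a given generating alphabet. -/
theorem exists_isRegular {M X : Type*} [Monoid M] {S : Set M} (h : IsRational S)
    {π : FreeMonoid X →* M} (hπ : Function.Surjective π) :
    ∃ L : Language X, L.IsRegular ∧ {g | ∃ w ∈ L, π (FreeMonoid.ofList w) = g} = S := by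
  induction h with
  | empty => exact ⟨0, Language.isRegular_zero, by simp [Language.notMem_zero]⟩
  | singleton a =>
    obtain ⟨w, rfl⟩ := hπ a
    refine ⟨_, Language.isRegular_singleton w.toList, ?_⟩
    ext g
    constructor
    · rintro ⟨_, rfl, rfl⟩
      rfl
    · rintro rfl
      exact ⟨_, rfl, rfl⟩
  | union _ _ hS hT =>
    obtain ⟨L, hL, rfl⟩ := hS
    obtain ⟨K, hK, rfl⟩ := hT
    refine ⟨L + K, hL.add hK, ?_⟩
    ext g
    simp only [Language.mem_add, Set.mem_ofPred_eq, Set.mem_union]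
    grind
  | mul _ _ hS hT =>
    obtain ⟨L, hL, rfl⟩ := hS
    obtain ⟨K, hK, rfl⟩ := hT
    refine ⟨L * K, hL.mul hK, ?_⟩
    ext g
    constructor
    · rintro ⟨_, ⟨u, hu, v, hv, rfl⟩, rfl⟩
      exact ⟨_, ⟨u, hu, rfl⟩, _, ⟨v, hv, rfl⟩, (map_mul π _ _).symm⟩
    · rintro ⟨_, ⟨u, hu, rfl⟩, _, ⟨v, hv, rfl⟩, rfl⟩
      exact ⟨u ++ v, Language.append_mem_mul hu hv, map_mul π _ _⟩
  | closure _ hS =>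
    obtain ⟨L, hL, rfl⟩ := hS
    refine ⟨KStar.kstar L, hL.kstar, ?_⟩
    ext g
    constructor
    · rintro ⟨w, hw, rfl⟩
      obtain ⟨W, rfl, hW⟩ := Language.mem_kstar.1 hw
      clear hw
      induction W with
      | nil => exact (map_one π).symm ▸ one_mem _
      | cons u W ih =>
        rw [List.flatten_cons, FreeMonoid.ofList_append, map_mul]
        exact mul_mem (Submonoid.subset_closure ⟨u, hW u (by simp), rfl⟩)
          (ih fun y hy => hW y (by simp [hy]))
    · intro hg
      induction hg using Submonoid.closure_induction with
      | mem _ h =>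
        obtain ⟨w, hw, rfl⟩ := h
        exact ⟨w, Language.mem_kstar.2 ⟨[w], by simp, by simpa using hw⟩, rfl⟩
      | one => exact ⟨[], Language.nil_mem_kstar _, map_one π⟩
      | mul _ _ _ _ hx hy =>
        obtain ⟨u, hu, rfl⟩ := hx
        obtain ⟨v, hv, rfl⟩ := hy
        refine ⟨u ++ v, ?_, map_mul π _ _⟩
        rw [← kstar_mul_kstar]
        exact Language.append_mem_mul hu hv

end IsRational

/-- The least solution, restricted to transitions into `T`, of the right-linear system of
equations `Y p = F p ∪ ⋃ q ∈ T, R p q * Y q`. -/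
inductive LinearSolution {M Q : Type*} [Monoid M] (T : Set Q) (R : Q → Q → Set M) (F : Q → Set M) :
    Q → M → Prop
  | base {p : Q} {a : M} : a ∈ F p → LinearSolution T R F p a
  | step {p q : Q} {a b : M} : q ∈ T → a ∈ R p q → LinearSolution T R F q b →
      LinearSolution T R F p (a * b)

namespace LinearSolution

variable {M Q : Type*} [Monoid M]

/-- State elimination: a passage through `s` is an entry, some loops at `s` and an exit, and can be
contracted into a single transition or final output. -/
theorem insert_iff {T : Set Q} {R : Q → Q → Set M} {F : Q → Set M} {s p : Q} {a : M} :
    LinearSolution (insert s T) R F p a ↔ LinearSolution T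
      (fun p q => R p q ∪ R p s * (Submonoid.closure (R s s) * R s q))
      (fun p => F p ∪ R p s * (Submonoid.closure (R s s) * F s)) p a := by
  have absorb {v : M} {V : Set M} (hv : v ∈ V ∪ R s s * (Submonoid.closure (R s s) * V)) :
      v ∈ (Submonoid.closure (R s s) : Set M) * V := by
    rcases hv with hv | ⟨x, hx, _, ⟨y, hy, z, hz, rfl⟩, rfl⟩
    · exact ⟨1, one_mem _, v, hv, one_mul v⟩
    · exact ⟨x * y, mul_mem (Submonoid.subset_closure hx) hy, z, hz, mul_assoc _ _ _⟩
  constructor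
  · intro h
    induction h with
    | base h => exact base (.inl h)
    | @step p q a b hq ha _ ih =>
      rcases hq with rfl | hq
      · cases ih with
        | base h => exact base (.inr ⟨a, ha, b, absorb h, rfl⟩)
        | @step _ q' u v hq' hu hv =>
          rw [← mul_assoc]
          exact step hq' (.inr ⟨a, ha, u, absorb hu, rfl⟩) hv
      · exact step hq (.inl ha) ih
  · have loop {u b : M} (hu : u ∈ Submonoid.closure (R s s))
        (hb : LinearSolution (insert s T) R F s b) :
        LinearSolution (insert s T) R F s (u * b) := by
      induction hu using Submonoid.closure_induction generalizing b with
      | mem x hx => exact step (.inl rfl) hx hb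
      | one => simpa using hb
      | mul x y _ _ hx hy => simpa [mul_assoc] using hx (hy hb)
    intro h
    induction h with
    | base h =>
      rcases h with h | ⟨x, hx, _, ⟨y, hy, z, hz, rfl⟩, rfl⟩
      · exact base h
      · exact step (.inl rfl) hx (loop hy (base hz))
    | step hq ha _ ih =>
      rcases ha with ha | ⟨x, hx, _, ⟨y, hy, z, hz, rfl⟩, rfl⟩
      · exact step (.inr hq) ha ih
      · simp only [mul_assoc]
        exact step (.inl rfl) hx (loop hy (step (.inr hq) hz ih))

/-- The least solution of a finite rational right-linear system consists of rational sets. -/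
theorem isRational [Finite Q] {R : Q → Q → Set M} {F : Q → Set M}
    (hR : ∀ p q, IsRational (R p q)) (hF : ∀ p, IsRational (F p)) (p : Q) :
    IsRational {a | LinearSolution Set.univ R F p a} := by
  suffices ∀ T : Set Q, T.Finite → ∀ (R : Q → Q → Set M) (F : Q → Set M),
      (∀ p q, IsRational (R p q)) → (∀ p, IsRational (F p)) → ∀ p,
      IsRational {a | LinearSolution T R F p a} from this _ Set.finite_univ R F hR hF p
  intro T hT
  induction T, hT using Set.Finite.induction_on with
  | empty =>
    intro R F _ hF p
    convert! hF p using 1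
    ext a
    refine ⟨fun h => ?_, base⟩
    cases h with
    | base h => exact h
    | step hq => exact hq.elim
  | insert _ _ ih =>
    intro R F hR hF p
    simp only [insert_iff]
    exact ih _ _ (fun p q => (hR p q).union ((hR _ _).mul ((hR _ _).closure.mul (hR _ _))))
      (fun p => (hF p).union ((hR _ _).mul ((hR _ _).closure.mul (hF _)))) p

end LinearSolution

/-- The evaluations of words accepted from each state solve a finite right-linear system with finite
coefficients. -/
theorem IsRegularSubset.isRational {G : Type*} [Group G] {S : Set G} (h : IsRegularSubset S) :
    IsRational S := by
  obtain ⟨X, _, π, L, -, ⟨σ, _, A, rfl⟩, rfl⟩ := h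
  have key : ∀ (p : σ) (g : G), LinearSolution Set.univ
      (fun p q => (fun x => π (.of x)) '' {x | A.step p x = q})
      (fun p => {g | p ∈ A.accept ∧ g = 1}) p g ↔
      ∃ w : List X, A.evalFrom p w ∈ A.accept ∧ π (.ofList w) = g := by
    intro p g
    constructor
    · intro h
      induction h with
      | base h =>
        obtain ⟨h, rfl⟩ := h
        exact ⟨[], h, map_one π⟩
      | step _ ha _ ih =>
        obtain ⟨x, rfl, rfl⟩ := ha
        obtain ⟨w, hw, rfl⟩ := ih
        exact ⟨x :: w, hw, map_mul π (.of x) _⟩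
    · rintro ⟨w, hw, rfl⟩
      induction w generalizing p with
      | nil => exact .base ⟨hw, map_one π⟩
      | cons x w ih =>
        rw [FreeMonoid.ofList_cons, map_mul]
        exact .step (Set.mem_univ _) ⟨x, rfl, rfl⟩ (ih _ hw)
  have hrat := LinearSolution.isRational
    (R := fun p q => (fun x => π (.of x)) '' {x | A.step p x = q})
    (F := fun p => {g | p ∈ A.accept ∧ g = 1})
    (fun p q => .of_finite ((Set.toFinite _).image _))
    (fun p => .of_finite ((Set.finite_singleton 1).subset fun g hg => hg.2)) A.start
  simp only [key] at hrat
  exact hrat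

/-- A rational subset of a group all of whose elements form a rational set is regular. -/
theorem IsRational.isRegularSubset {G : Type*} [Group G] {S : Set G} (h : IsRational S)
    (hG : IsRational (Set.univ : Set G)) : IsRegularSubset S := by
  obtain ⟨T, hT, hTG⟩ := hG.exists_finite_subset_closure
  obtain ⟨k, f, hf⟩ := hT.fin_param
  have hπ : Function.Surjective (FreeMonoid.lift f) := by
    rw [← MonoidHom.mrange_eq_top, FreeMonoid.mrange_lift, hf.2]
    exact top_unique fun g _ => hTG (Set.mem_univ g)
  obtain ⟨L, hL, hLS⟩ := h.exists_isRegular hπ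
  exact ⟨Fin k, inferInstance, _, L, hπ, hL, hLS⟩

namespace IsPositiveCone

variable {G : Type*} [Group G] {P : Set G}

/-- Rationality of the whole group yields the finite generating alphabet that regularity demands. -/
theorem isRational_univ (hP : IsPositiveCone P) (h : IsRational P) :
    IsRational (Set.univ : Set G) := by
  have : (Set.univ : Set G) = P ∪ ({1} ∪ P⁻¹) := by
    ext g
    exact ⟨fun _ => hP.cover g, fun _ => Set.mem_univ g⟩
  rw [this]
  exact h.union ((IsRational.singleton 1).union h.inv)

theorem hasRegularLeftOrder (hP : IsPositiveCone P) (h : IsRational P) :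
    HasRegularLeftOrder G := by
  refine ⟨fun a b => a⁻¹ * b ∈ P, ⟨{ trichotomous := ?_, irrefl := ?_, trans := ?_ }, ?_⟩, ?_⟩
  · intro a b hab hba
    rcases hP.cover (a⁻¹ * b) with h | h | h
    · exact absurd h hab
    · exact inv_mul_eq_one.1 h
    · exact absurd (by simpa using h) hba
  · intro a ha
    exact hP.one_notMem (by simpa using ha)
  · intro a b c hab hbc
    simpa [mul_assoc] using hP.mul_mem _ hab _ hbc
  · intro a b c
    simp [mul_assoc]
  · simpa using h.isRegularSubset (hP.isRational_univ h)

end IsPositiveCone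

end RegularOrder

/-! ### Weights, reduced words and the quasimorphism bound -/

namespace RegularOrder

variable {ι : Type*} {G : ι → Type*}

/-- The weight of a word: the sum of the signs `e` of its letters and of the signs `t` of the turns
between consecutive letters. -/
def wordWeight (t : ι → ι → ℤ) (e : ∀ i, G i → ℤ) : List (Σ i, G i) → ℤ
  | [] => 0
  | [x] => e x.1 x.2
  | x :: y :: l => e x.1 x.2 + t x.1 y.1 + wordWeight t e (y :: l)

section wordWeight

variable {t : ι → ι → ℤ} {e : ∀ i, G i → ℤ}

/-- Turn signs see only the factors, so a head letter may be exchanged within its factor at the cost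
of its own sign. -/
theorem wordWeight_cons_sub_eq (i : ι) (x y : G i) (l : List (Σ i, G i)) :
    wordWeight t e (⟨i, x⟩ :: l) - e i x = wordWeight t e (⟨i, y⟩ :: l) - e i y := by
  cases l with
  | nil => simp [wordWeight]
  | cons => simp only [wordWeight]; ring

/-- Storing the left word reversed puts the junction at the two heads, where recursion on lists can
reach it; its turns are then read backwards, hence `flip t`. -/
theorem wordWeight_reverseAux (a b : List (Σ i, G i)) (x y : Σ i, G i) :
    wordWeight t e (List.reverseAux (x :: a) (y :: b)) =
      wordWeight (flip t) e (x :: a) + t x.1 y.1 + wordWeight t e (y :: b) := by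
  induction a generalizing x y b with
  | nil => simp [wordWeight]
  | cons x' a ih =>
    rw [List.reverseAux_cons, ih]
    simp only [wordWeight, flip]
    ring

theorem wordWeight_reverse (a : List (Σ i, G i)) :
    wordWeight t e a.reverse = wordWeight (flip t) e a := by
  rcases a with _ | ⟨x, _ | ⟨x', a⟩⟩
  · rfl
  · rfl
  · change wordWeight t e (List.reverseAux (x' :: a) [x]) = _
    rw [wordWeight_reverseAux]
    simp only [wordWeight, flip]
    ring

theorem wordWeight_reverseAux_cons (a b : List (Σ i, G i)) (i : ι) (x y z : G i) :
    wordWeight t e (List.reverseAux a (⟨i, z⟩ :: b)) =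
      wordWeight (flip t) e (⟨i, x⟩ :: a) - e i x + e i z +
        (wordWeight t e (⟨i, y⟩ :: b) - e i y) := by
  rw [wordWeight_cons_sub_eq i y z]
  rcases a with _ | ⟨x', a⟩
  · simp [wordWeight]
  · rw [wordWeight_reverseAux]
    simp only [wordWeight, flip]
    ring

/-- A word with `n > 0` letters has `n - 1` turns, so the weight has `2n - 1` odd summands. -/
theorem odd_wordWeight (ht : ∀ i j, i ≠ j → Odd (t i j)) (he : ∀ i g, Odd (e i g))
    {l : List (Σ i, G i)} (hl : l.IsChain fun x y => x.1 ≠ y.1) (hne : l ≠ []) :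
    Odd (wordWeight t e l) := by
  induction l with
  | nil => exact absurd rfl hne
  | cons x l ih =>
    rcases l with _ | ⟨y, l⟩
    · exact he _ _
    · rw [List.isChain_cons_cons] at hl
      exact ((he _ _).add_odd (ht _ _ hl.1)).add_odd (ih hl.2 (by simp))

end wordWeight

variable [∀ i, Group (G i)] {C : Type*} [Group C] (φ : ∀ i, C →* G i)

/-- A word is reduced if its letters avoid the amalgamated subgroup and consecutive letters are in
distinct factors. -/
def IsReducedWord (l : List (Σ i, G i)) : Prop :=
  (∀ x ∈ l, x.2 ∉ (φ x.1).range) ∧ l.IsChain fun x y => x.1 ≠ y.1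

/-- The element of the amalgamated product that is represented by a word. -/
def wordProd (l : List (Σ i, G i)) : Monoid.PushoutI φ :=
  (l.map fun x => Monoid.PushoutI.of x.1 x.2).prod

variable {φ}

@[simp]
theorem wordProd_nil : wordProd φ [] = 1 := rfl

@[simp]
theorem wordProd_cons (x : Σ i, G i) (l : List (Σ i, G i)) :
    wordProd φ (x :: l) = Monoid.PushoutI.of x.1 x.2 * wordProd φ l := by
  simp [wordProd]

theorem wordProd_reverseAux (a b : List (Σ i, G i)) :
    wordProd φ (List.reverseAux a b) = wordProd φ a.reverse * wordProd φ b := by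
  simp [wordProd, List.reverseAux_eq]

theorem wordProd_reverse_cons (x : Σ i, G i) (l : List (Σ i, G i)) :
    wordProd φ (x :: l).reverse = wordProd φ l.reverse * Monoid.PushoutI.of x.1 x.2 := by
  simp [wordProd]

namespace IsReducedWord

theorem nil : IsReducedWord φ [] := ⟨by simp, by simp⟩

theorem singleton {i : ι} {g : G i} (hg : g ∉ (φ i).range) : IsReducedWord φ [⟨i, g⟩] :=
  ⟨by simpa using hg, by simp⟩

theorem reverse {l : List (Σ i, G i)} (h : IsReducedWord φ l) : IsReducedWord φ l.reverse := by
  refine ⟨by simpa using h.1, ?_⟩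
  rw [List.isChain_reverse]
  exact h.2.imp fun _ _ h => h.symm

theorem tail {x : Σ i, G i} {l : List (Σ i, G i)} (h : IsReducedWord φ (x :: l)) :
    IsReducedWord φ l :=
  ⟨fun y hy => h.1 y (by simp [hy]), h.2.tail⟩

theorem head {x : Σ i, G i} {l : List (Σ i, G i)} (h : IsReducedWord φ (x :: l)) :
    x.2 ∉ (φ x.1).range :=
  h.1 x (by simp)

theorem cons_cons {x y : Σ i, G i} {l : List (Σ i, G i)} :
    IsReducedWord φ (x :: y :: l) ↔
      x.2 ∉ (φ x.1).range ∧ x.1 ≠ y.1 ∧ IsReducedWord φ (y :: l) := by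
  simp only [IsReducedWord, List.isChain_cons_cons, List.forall_mem_cons]
  tauto

theorem replace_head {i : ι} {g g' : G i} {l : List (Σ i, G i)}
    (h : IsReducedWord φ (⟨i, g⟩ :: l)) (hg' : g' ∉ (φ i).range) :
    IsReducedWord φ (⟨i, g'⟩ :: l) := by
  rcases l with _ | ⟨y, l⟩
  · exact singleton hg'
  · rw [cons_cons] at h ⊢
    exact ⟨hg', h.2⟩

theorem reverseAux {a b : List (Σ i, G i)} (ha : IsReducedWord φ a) (hb : IsReducedWord φ b)
    (h : ∀ x ∈ a.head?, ∀ y ∈ b.head?, x.1 ≠ y.1) : IsReducedWord φ (List.reverseAux a b) := by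
  induction a generalizing b with
  | nil => exact hb
  | cons x a ih =>
    rw [List.reverseAux_cons]
    refine ih ha.tail ?_ ?_
    · rcases b with _ | ⟨y, b⟩
      · exact singleton ha.head
      · exact cons_cons.2 ⟨ha.head, h x rfl y rfl, hb⟩
    · rintro y hy z hz
      rcases a with _ | ⟨y', a⟩
      · simp at hy
      · obtain rfl : y' = y := by simpa using hy
        obtain rfl : x = z := by simpa using hz
        exact (cons_cons.1 ha).2.1.symm

/-- A reduced word representing an element of the amalgamated subgroup is empty. -/
theorem eq_nil {l : List (Σ i, G i)} (h : IsReducedWord φ l)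
    (hφ : ∀ i, Function.Injective (φ i))
    (hl : wordProd φ l ∈ (Monoid.PushoutI.base φ).range) : l = [] := by
  let w : Monoid.CoprodI.Word G :=
    ⟨l, fun x hx h1 => h.1 x hx (by rw [h1]; exact one_mem _), h.2⟩
  have hw : Monoid.PushoutI.ofCoprodI w.prod = wordProd φ l := by
    simp [Monoid.CoprodI.Word.prod, wordProd, w, map_list_prod, Function.comp_def]
  have := Monoid.PushoutI.Reduced.eq_empty_of_mem_range hφ (w := w) h.1 (hw ▸ hl)
  exact congrArg Monoid.CoprodI.Word.toList this

end IsReducedWord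

/-- Sign functions on the letters and on the turns for which the weight of reduced words is a
quasimorphism. -/
structure IsSignSystem (φ : ∀ i, C →* G i) (t : ι → ι → ℤ) (e : ∀ i, G i → ℤ) : Prop where
  turn_abs : ∀ i j, i ≠ j → t i j = 1 ∨ t i j = -1
  turn_antisymm : ∀ i j, t i j = -t j i
  turn_triangle : ∀ i j k, i ≠ j → j ≠ k → i ≠ k → |t i k - t i j - t j k| ≤ 1
  sign_abs : ∀ i g, e i g = 1 ∨ e i g = -1
  sign_mul_base : ∀ i g c, g ∉ (φ i).range → e i (g * φ i c) = e i g
  sign_mul_mem : ∀ i g h, g ∉ (φ i).range → h ∉ (φ i).range → g * h ∈ (φ i).range →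
    e i g + e i h = 0
  sign_mul_notMem : ∀ i g h, g ∉ (φ i).range → h ∉ (φ i).range → g * h ∉ (φ i).range →
    |e i (g * h) - e i g - e i h| ≤ 1

section merge

variable {t : ι → ι → ℤ} {e : ∀ i, G i → ℤ}

open Monoid.PushoutI

theorem mul_base_notMem {i : ι} {g : G i} (c : C) (h : g ∉ (φ i).range) :
    g * φ i c ∉ (φ i).range :=
  fun h' => h ((Subgroup.mul_mem_cancel_right _ (MonoidHom.mem_range.2 ⟨c, rfl⟩)).1 h')

/-- The product of two elements given by reduced words is given by a reduced word, the weight of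
which is the sum of the two weights up to an error of `1`. -/
theorem IsSignSystem.exists_merge (hs : IsSignSystem φ t e) {a b : List (Σ i, G i)}
    (ha : IsReducedWord φ a) (hb : IsReducedWord φ b) (c : C) :
    ∃ l c', IsReducedWord φ l ∧
      wordProd φ a.reverse * base φ c * wordProd φ b = base φ c' * wordProd φ l ∧
      |wordWeight t e l - wordWeight (flip t) e a - wordWeight t e b| ≤ 1 ∧
      (a = [] ∨ b = [] →
        wordWeight t e l = wordWeight (flip t) e a + wordWeight t e b) ∧
      ∀ x ∈ a.head?, ∀ y ∈ b.head?, x.1 ≠ y.1 →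
        wordWeight t e l = wordWeight (flip t) e a + t x.1 y.1 + wordWeight t e b := by
  have weight_base (i : ι) (x : G i) (hx : x ∉ (φ i).range) (c : C) (a : List (Σ i, G i)) :
      wordWeight (flip t) e (⟨i, x * φ i c⟩ :: a) = wordWeight (flip t) e (⟨i, x⟩ :: a) := by
    have := wordWeight_cons_sub_eq (t := flip t) (e := e) i x (x * φ i c) a
    rw [hs.sign_mul_base i x c hx] at this
    linarith
  -- The two exact clauses strengthen the induction: after a cancellation they tell whether the
  -- process has stopped, so errors do not accumulate.
  induction a generalizing b c with
  | nil => exact ⟨b, c, hb, by simp, by simp [wordWeight], by simp [wordWeight], by simp⟩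
  | cons x a ih =>
    obtain ⟨i, x⟩ := x
    have hx : x ∉ (φ i).range := ha.head
    have hxc := mul_base_notMem c hx
    rcases b with _ | ⟨⟨j, y⟩, b⟩
    · have hw : wordWeight t e (⟨i, x * φ i c⟩ :: a).reverse =
          wordWeight (flip t) e (⟨i, x⟩ :: a) + wordWeight t e [] := by
        rw [wordWeight_reverse, weight_base i x hx]
        simp [wordWeight]
      refine ⟨(⟨i, x * φ i c⟩ :: a).reverse, 1, (ha.replace_head hxc).reverse, ?_,
        by rw [hw]; simp [wordWeight], fun _ => hw, by simp⟩
      rw [wordProd_reverse_cons, wordProd_reverse_cons]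
      simp [mul_assoc, of_apply_eq_base]
    have hy : y ∉ (φ j).range := hb.head
    by_cases hij : i = j
    · subst hij
      by_cases hz : x * φ i c * y ∈ (φ i).range
      · obtain ⟨c₂, hc₂⟩ := hz
        obtain ⟨l, c', hl, hprod, hle, hnil, hhead⟩ := ih ha.tail hb.tail c₂
        -- The cancelled letters have opposite signs, so only their adjacent turns remain to be
        -- compared.
        have he : e i x + e i y = 0 := by
          rw [← hs.sign_mul_base i x c hx]
          exact hs.sign_mul_mem i _ _ hxc hy ⟨c₂, hc₂⟩
        refine ⟨l, c', hl, ?_, ?_, by simp, by simp⟩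
        · rw [← hprod, wordProd_reverse_cons, wordProd_cons, ← of_apply_eq_base φ i c,
            ← of_apply_eq_base φ i c₂, hc₂]
          simp [mul_assoc]
        · rcases a with _ | ⟨x', a⟩
          · rw [hnil (.inl rfl)]
            rcases b with _ | ⟨y', b⟩
            · simp only [wordWeight]
              rw [abs_le]
              omega
            · have := hs.turn_abs i y'.1 (IsReducedWord.cons_cons.1 hb).2.1
              simp only [wordWeight]
              rw [abs_le]
              omega
          · have hxi := (IsReducedWord.cons_cons.1 ha).2.1
            have hxt := hs.turn_abs x'.1 i (Ne.symm hxi)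
            rcases b with _ | ⟨y', b⟩
            · rw [hnil (.inr rfl)]
              simp only [wordWeight, flip]
              rw [abs_le]
              omega
            · have hyi := (IsReducedWord.cons_cons.1 hb).2.1
              -- If the next heads share a factor, the two lost turns cancel by antisymmetry and the
              -- inductive bound is inherited. Otherwise cancellation stops, and the new turn
              -- replaces the two old ones within the triangle bound.
              by_cases hxy : x'.1 = y'.1
              · have := hs.turn_antisymm x'.1 i
                rw [abs_le] at hle ⊢
                simp only [wordWeight, flip] at hle ⊢
                rw [← hxy]
                omega
              · rw [hhead x' rfl y' rfl hxy]
                have := hs.turn_triangle x'.1 i y'.1 (Ne.symm hxi) hyi hxy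
                rw [abs_le] at this ⊢
                simp only [wordWeight, flip] at this ⊢
                omega
      · refine ⟨List.reverseAux a (⟨i, x * φ i c * y⟩ :: b), 1, ?_, ?_, ?_, by simp, by simp⟩
        · exact (ha.replace_head hz).tail.reverseAux (hb.replace_head hz) (by
            intro x' hx' y' hy'
            obtain rfl : _ = y' := by simpa using hy'
            rcases a with _ | ⟨x'', a⟩
            · simp at hx'
            · obtain rfl : x'' = x' := by simpa using hx'
              exact (IsReducedWord.cons_cons.1 ha).2.1.symm)
        · rw [wordProd_reverseAux, wordProd_reverse_cons]
          simp [mul_assoc, of_apply_eq_base]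
        · have := hs.sign_mul_notMem i _ _ hxc hy hz
          rw [hs.sign_mul_base i x c hx] at this
          rw [wordWeight_reverseAux_cons a b i x y]
          rw [abs_le] at this ⊢
          constructor <;> linarith
    · have hw : wordWeight t e (List.reverseAux (⟨i, x * φ i c⟩ :: a) (⟨j, y⟩ :: b)) =
          wordWeight (flip t) e (⟨i, x⟩ :: a) + t i j + wordWeight t e (⟨j, y⟩ :: b) := by
        rw [wordWeight_reverseAux, weight_base i x hx]
      refine ⟨_, 1, (ha.replace_head hxc).reverseAux hb (by simpa using hij), ?_, ?_, by simp,
        by simpa using fun _ => hw⟩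
      · rw [wordProd_reverseAux, wordProd_reverse_cons, wordProd_reverse_cons]
        simp [mul_assoc, of_apply_eq_base]
      · rw [hw, abs_le]
        have := hs.turn_abs i j hij
        omega

theorem IsSignSystem.exists_mul (hs : IsSignSystem φ t e) {a b : List (Σ i, G i)}
    (ha : IsReducedWord φ a) (hb : IsReducedWord φ b) (c₁ c₂ : C) :
    ∃ l c, IsReducedWord φ l ∧
      (base φ c₁ * wordProd φ a) * (base φ c₂ * wordProd φ b) = base φ c * wordProd φ l ∧
      |wordWeight t e l - wordWeight t e a - wordWeight t e b| ≤ 1 ∧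
      (a = [] ∨ b = [] → wordWeight t e l = wordWeight t e a + wordWeight t e b) := by
  obtain ⟨l, c, hl, hprod, hle, hnil, -⟩ := hs.exists_merge ha.reverse hb c₂
  have hw : wordWeight (flip t) e a.reverse = wordWeight t e a := wordWeight_reverse a
  rw [hw] at hle hnil
  refine ⟨l, c₁ * c, hl, ?_, hle, by simpa using hnil⟩
  rw [List.reverse_reverse] at hprod
  rw [map_mul, mul_assoc (base φ c₁) (base φ c), ← hprod]
  simp only [mul_assoc]

/-- Every element of the amalgamated product is given by a reduced word. -/
theorem IsSignSystem.exists_isReducedWord (hs : IsSignSystem φ t e) (g : Monoid.PushoutI φ) :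
    ∃ c l, IsReducedWord φ l ∧ g = base φ c * wordProd φ l := by
  induction g using Monoid.PushoutI.induction_on with
  | of i g =>
    by_cases hg : g ∈ (φ i).range
    · obtain ⟨c, rfl⟩ := hg
      exact ⟨c, [], .nil, by simp [of_apply_eq_base]⟩
    · exact ⟨1, _, .singleton hg, by simp⟩
  | base c => exact ⟨c, [], .nil, by simp⟩
  | mul x y hx hy =>
    obtain ⟨c₁, a, ha, rfl⟩ := hx
    obtain ⟨c₂, b, hb, rfl⟩ := hy
    obtain ⟨l, c, hl, h, -⟩ := hs.exists_mul ha hb c₁ c₂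
    exact ⟨c, l, hl, h⟩

end merge

end RegularOrder

/-! ### The positive cone of the product with the integers -/

namespace RegularOrder

open Monoid.PushoutI Multiplicative
open scoped Pointwise

namespace IsRelPositiveCone

variable {G : Type*} [Group G] {P : Set G} {H : Subgroup G}

theorem mul_subgroup_mem (hP : IsRelPositiveCone P H) {g h : G} (hg : g ∈ P) (hh : h ∈ H) :
    g * h ∈ P := by
  rcases hP.cover (g * h) with h' | h' | h'
  · exact h'
  · exact absurd ((Subgroup.mul_mem_cancel_right _ hh).1 h') (hP.disjoint_subgroup g hg)
  · refine absurd (H.inv_mem hh) (hP.disjoint_subgroup _ ?_)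
    simpa using hP.mul_mem _ h' _ hg

theorem mul_subgroup_mem_iff (hP : IsRelPositiveCone P H) {g h : G} (hh : h ∈ H) :
    g * h ∈ P ↔ g ∈ P :=
  ⟨fun h' => by simpa using hP.mul_subgroup_mem h' (H.inv_mem hh),
    fun h' => hP.mul_subgroup_mem h' hh⟩

theorem inv_mem (hP : IsRelPositiveCone P H) {g : G} (hg : g ∉ H) (hg' : g ∉ P) : g⁻¹ ∈ P :=
  ((hP.cover g).resolve_left hg').resolve_left hg

end IsRelPositiveCone

/-- The sign of a turn between two factors in a linearly ordered family. -/
def turnSign {ι : Type*} [LinearOrder ι] (i j : ι) : ℤ :=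
  if i < j then 1 else if j < i then -1 else 0

open Classical in
/-- The sign of an element with respect to a set of positive elements. -/
noncomputable def coneSign {ι : Type*} {G : ι → Type*} (P : ∀ i, Set (G i)) (i : ι) (g : G i) : ℤ :=
  if g ∈ P i then 1 else -1

/-- The value of a sign. -/
def boolSign (b : Bool) : ℤ := if b then 1 else -1

variable {ι : Type*} {G : ι → Type*} [∀ i, Group (G i)] {C : Type*} [Group C] {φ : ∀ i, C →* G i}

/-- The bounds on triples hold because three odd signs could exceed 1 in absolute value only by all
agreeing, which would give a cycle in the order or contradict closure of a cone under products. -/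
theorem isSignSystem [LinearOrder ι] {P : ∀ i, Set (G i)}
    (hP : ∀ i, IsRelPositiveCone (P i) (φ i).range) :
    IsSignSystem φ turnSign (coneSign P) where
  turn_abs i j h := by
    rcases h.lt_or_gt with h | h <;> simp [turnSign, h, h.not_gt]
  turn_antisymm i j := by
    rcases lt_trichotomy i j with h | h | h <;> simp [turnSign, h, h.not_gt]
  turn_triangle i j k hij hjk hik := by
    unfold turnSign
    rcases hij.lt_or_gt with h₁ | h₁ <;> rcases hjk.lt_or_gt with h₂ | h₂ <;>
      rcases hik.lt_or_gt with h₃ | h₃ <;> simp only [h₁, h₂, h₃, h₁.not_gt, h₂.not_gt,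
        h₃.not_gt, if_true, if_false] <;> first | (exfalso; order) | norm_num
  sign_abs i g := by
    unfold coneSign
    split_ifs <;> simp
  sign_mul_base i g c _ := by
    unfold coneSign
    classical exact if_congr ((hP i).mul_subgroup_mem_iff ⟨c, rfl⟩) rfl rfl
  sign_mul_mem i g h hg hh hgh := by
    unfold coneSign
    split_ifs with h₁ h₂ h₂
    · exact absurd hgh ((hP i).disjoint_subgroup _ ((hP i).mul_mem _ h₁ _ h₂))
    · simp
    · simp
    · refine absurd (inv_mem hgh) ((hP i).disjoint_subgroup _ ?_)
      rw [mul_inv_rev]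
      exact (hP i).mul_mem _ ((hP i).inv_mem hh h₂) _ ((hP i).inv_mem hg h₁)
  sign_mul_notMem i g h hg hh hgh := by
    unfold coneSign
    by_cases h₁ : g ∈ P i <;> by_cases h₂ : h ∈ P i
    · simp [h₁, h₂, (hP i).mul_mem _ h₁ _ h₂]
    · split_ifs <;> norm_num
    · split_ifs <;> norm_num
    · have h₃ := (hP i).mul_mem _ ((hP i).inv_mem hh h₂) _ ((hP i).inv_mem hg h₁)
      rw [← mul_inv_rev] at h₃
      have h₄ : g * h ∉ P i := fun h => (hP i).disjoint_inv _ h h₃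
      simp [h₁, h₂, h₄]

/-- The elements `(g, m)` for which twice `m` plus the weight of `g` is positive, together with the
positive elements of the amalgamated subgroup. -/
def weightCone (φ : ∀ i, C →* G i) (t : ι → ι → ℤ) (e : ∀ i, G i → ℤ) (Q : Set C) :
    Set (Monoid.PushoutI φ × Multiplicative ℤ) :=
  {h | ∃ c l, IsReducedWord φ l ∧ h.1 = base φ c * wordProd φ l ∧
    (0 < 2 * toAdd h.2 + wordWeight t e l ∨ l = [] ∧ toAdd h.2 = 0 ∧ c ∈ Q)}

theorem IsSignSystem.isPositiveCone_weightCone {t : ι → ι → ℤ} {e : ∀ i, G i → ℤ}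
    (hs : IsSignSystem φ t e) (hφ : ∀ i, Function.Injective (φ i)) {Q : Set C}
    (hQ : IsPositiveCone Q) : IsPositiveCone (weightCone φ t e Q) := by
  have ht : ∀ i j, i ≠ j → Odd (t i j) := fun i j h => by
    rcases hs.turn_abs i j h with h | h <;> rw [h] <;> decide
  have he : ∀ i g, Odd (e i g) := fun i g => by
    rcases hs.sign_abs i g with h | h <;> rw [h] <;> decide
  have hmul : ∀ g ∈ weightCone φ t e Q, ∀ h ∈ weightCone φ t e Q,
      g * h ∈ weightCone φ t e Q := by
    rintro ⟨_, m₁⟩ ⟨c₁, a, ha, rfl, h₁⟩ ⟨_, m₂⟩ ⟨c₂, b, hb, rfl, h₂⟩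
    by_cases hab : a = [] ∧ toAdd m₁ = 0 ∧ c₁ ∈ Q ∧ b = [] ∧ toAdd m₂ = 0 ∧ c₂ ∈ Q
    · obtain ⟨rfl, hm₁, hc₁, rfl, hm₂, hc₂⟩ := hab
      exact ⟨c₁ * c₂, [], .nil, by simp, .inr ⟨rfl, by simp [hm₁, hm₂], hQ.mul_mem _ hc₁ _ hc₂⟩⟩
    · obtain ⟨l, c, hl, hprod, hle, hnil⟩ := hs.exists_mul ha hb c₁ c₂
      refine ⟨c, l, hl, hprod, .inl ?_⟩
      simp only [Prod.mk_mul_mk, toAdd_mul]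
      rw [abs_le] at hle
      -- Two positive integers sum to at least 2, which absorbs the defect 1. A factor from `C` at
      -- level 0 leaves no such slack, so exact additivity is used there.
      rcases h₁ with h₁ | ⟨rfl, hm₁, hc₁⟩ <;> rcases h₂ with h₂ | ⟨rfl, hm₂, hc₂⟩
      · dsimp only at h₁ h₂
        omega
      · rw [hnil (.inr rfl)]
        simp only [wordWeight] at *
        omega
      · rw [hnil (.inl rfl)]
        simp only [wordWeight] at *
        omega
      · exact absurd ⟨rfl, hm₁, hc₁, rfl, hm₂, hc₂⟩ hab
  have hone : (1 : Monoid.PushoutI φ × Multiplicative ℤ) ∉ weightCone φ t e Q := by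
    rintro ⟨c, l, hl, hprod, h⟩
    obtain rfl := hl.eq_nil hφ ⟨c⁻¹, by rw [map_inv]; exact inv_eq_of_mul_eq_one_right hprod.symm⟩
    rcases h with h | ⟨-, -, hc⟩
    · simp [wordWeight] at h
    · have : base φ c = 1 := by simpa using hprod.symm
      rw [← map_one (base φ)] at this
      exact hQ.one_notMem (base_injective hφ this ▸ hc)
  refine ⟨hmul, ?_, hone, fun g hg hg' => hone (by simpa using hmul _ hg _ hg')⟩
  rintro ⟨g, m⟩
  obtain ⟨c, l, hl, hg⟩ := hs.exists_isReducedWord g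
  obtain ⟨c', l', hl', hg'⟩ := hs.exists_isReducedWord g⁻¹
  by_cases hnil : l = []
  · subst hnil
    have hgc : g = base φ c := by simpa using hg
    have hgc' : g⁻¹ = base φ c⁻¹ * wordProd φ [] := by simp [hgc]
    rcases lt_trichotomy (toAdd m) 0 with hm | hm | hm
    · exact .inr (.inr ⟨c⁻¹, [], hl, hgc', .inl (by simp [wordWeight]; omega)⟩)
    · rcases hQ.cover c with hc | rfl | hc
      · exact .inl ⟨c, [], hl, hg, .inr ⟨rfl, hm, hc⟩⟩
      · exact .inr (.inl (Prod.ext (by simpa using hgc) hm))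
      · exact .inr (.inr ⟨c⁻¹, [], hl, hgc', .inr ⟨rfl, by simp [hm], hc⟩⟩)
    · exact .inl ⟨c, [], hl, hg, .inl (by simpa [wordWeight] using hm)⟩
  · have hnil' : l' ≠ [] := by
      rintro rfl
      refine hnil (hl.eq_nil hφ ⟨c⁻¹ * c'⁻¹, ?_⟩)
      have : g = (base φ c')⁻¹ := by
        rw [← inv_inv g, hg']
        simp
      rw [map_mul, map_inv, map_inv, ← this, hg, inv_mul_cancel_left]
    obtain ⟨l₃, c₃, hl₃, hprod, hle, -⟩ := hs.exists_mul hl hl' c c'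
    rw [← hg, ← hg', mul_inv_cancel] at hprod
    obtain rfl := hl₃.eq_nil hφ
      ⟨c₃⁻¹, by rw [map_inv]; exact inv_eq_of_mul_eq_one_right hprod.symm⟩
    -- The weights of `g` and its inverse are odd with sum at most 1 in absolute value, hence
    -- opposite; and `2m + w(g)` is never zero.
    obtain ⟨k, hk⟩ := odd_wordWeight ht he hl.2 hnil
    obtain ⟨k', hk'⟩ := odd_wordWeight ht he hl'.2 hnil'
    simp only [wordWeight] at hle
    rw [abs_le] at hle
    rcases lt_or_ge 0 (2 * toAdd m + wordWeight t e l) with hm | hm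
    · exact .inl ⟨c, l, hl, hg, .inl hm⟩
    · refine .inr (.inr ⟨c', l', hl', hg', .inl ?_⟩)
      simp only [Prod.inv_mk, toAdd_inv]
      omega

/-! ### Rationality of the cone -/

theorem isRational_central_ge (G : Type*) [Group G] (k : ℤ) :
    IsRational {h : G × Multiplicative ℤ | h.1 = 1 ∧ k ≤ toAdd h.2} := by
  convert! (IsRational.singleton ((1, ofAdd k) : G × Multiplicative ℤ)).mul
    (IsRational.singleton ((1, ofAdd 1) : G × Multiplicative ℤ)).closure using 1
  ext ⟨g, m⟩
  simp only [Set.mem_ofPred_eq, Set.singleton_mul, Set.mem_image, SetLike.mem_coe,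
    Submonoid.mem_closure_singleton, exists_exists_eq_and]
  constructor
  · rintro ⟨rfl, hm⟩
    obtain ⟨n, hn⟩ := Int.eq_ofNat_of_zero_le (sub_nonneg.2 hm)
    refine ⟨n, Prod.ext (by simp) (toAdd.injective ?_)⟩
    simp
    omega
  · rintro ⟨n, hn⟩
    have h₁ := congrArg Prod.fst hn
    have h₂ := congrArg (fun p => toAdd p.2) hn
    simp at h₁ h₂
    exact ⟨h₁.symm, by omega⟩

/-- The letters of factor `s.1` and sign `s.2`, as elements of `G × ℤ`. -/
def signedLetters (φ : ∀ i, C →* G i) (P : ∀ i, Set (G i)) (s : ι × Bool) :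
    Set (Monoid.PushoutI φ × Multiplicative ℤ) :=
  (MonoidHom.inl _ _).comp (of s.1) '' if s.2 then P s.1 else (P s.1)⁻¹

theorem mem_signedLetters {P : ∀ i, Set (G i)} (hP : ∀ i, IsRelPositiveCone (P i) (φ i).range)
    {s : ι × Bool} {h : Monoid.PushoutI φ × Multiplicative ℤ} :
    h ∈ signedLetters φ P s ↔
      ∃ g ∉ (φ s.1).range, coneSign P s.1 g = boolSign s.2 ∧ h = (of s.1 g, 1) := by
  obtain ⟨i, b⟩ := s
  refine exists_congr fun g => ?_
  have key : (g ∈ if b then P i else (P i)⁻¹) ↔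
      g ∉ (φ i).range ∧ coneSign P i g = boolSign b := by
    cases b
    · by_cases hg : g ∈ P i
      · simpa [coneSign, boolSign, hg] using (hP i).disjoint_inv g hg
      · simp only [coneSign, boolSign, hg, Bool.false_eq_true, if_false, Set.mem_inv, and_true]
        exact ⟨fun h h' => (hP i).disjoint_subgroup _ h (inv_mem h'), fun h => (hP i).inv_mem h hg⟩
    · by_cases hg : g ∈ P i
      · simpa [coneSign, boolSign, hg] using (hP i).disjoint_subgroup g hg
      · simp [coneSign, boolSign, hg]
  rw [key, and_assoc]
  simp only [MonoidHom.comp_apply, MonoidHom.inl_apply, eq_comm]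

theorem isRational_signedLetters {P : ∀ i, Set (G i)} (h : ∀ i, IsRational (P i))
    (s : ι × Bool) : IsRational (signedLetters φ P s) := by
  refine IsRational.image ?_ _
  split_ifs
  exacts [h _, (h _).inv]

/-- The transitions of the automaton that reads reduced words while the central factor records
their weight. -/
def weightStep (φ : ∀ i, C →* G i) [LinearOrder ι] (P : ∀ i, Set (G i)) (s s' : ι × Bool) :
    Set (Monoid.PushoutI φ × Multiplicative ℤ) :=
  if s.1 ≠ s'.1 then
    signedLetters φ P s * {(1, ofAdd (-((boolSign s.2 + turnSign s.1 s'.1) / 2)))} else ∅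

/-- The final outputs of the automaton that reads reduced words. -/
def weightFinal (φ : ∀ i, C →* G i) (P : ∀ i, Set (G i)) (s : ι × Bool) :
    Set (Monoid.PushoutI φ × Multiplicative ℤ) :=
  signedLetters φ P s * {h | h.1 = 1 ∧ (if s.2 then 0 else 1) ≤ toAdd h.2}

/-- Each transition lowers the central coordinate by exactly what its letter and turn add to half
the weight, so `2m + w` of the remaining word is unchanged along a run. -/
theorem linearSolution_weight_iff [LinearOrder ι] {P : ∀ i, Set (G i)}
    (hP : ∀ i, IsRelPositiveCone (P i) (φ i).range)
    (s : ι × Bool) (h : Monoid.PushoutI φ × Multiplicative ℤ) :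
    LinearSolution Set.univ (weightStep φ P) (weightFinal φ P) s h ↔
      ∃ g l, IsReducedWord φ (⟨s.1, g⟩ :: l) ∧ coneSign P s.1 g = boolSign s.2 ∧
        h.1 = wordProd φ (⟨s.1, g⟩ :: l) ∧
        0 < 2 * toAdd h.2 + wordWeight turnSign (coneSign P) (⟨s.1, g⟩ :: l) := by
  have hs := isSignSystem hP
  have half (b : Bool) (i j : ι) (hij : i ≠ j) :
      2 * ((boolSign b + turnSign i j) / 2) = boolSign b + turnSign i j := by
    rcases hs.turn_abs i j hij with h | h <;> cases b <;> simp [boolSign, h]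
  -- When one letter is left, `2m + 1 > 0` means `m ≥ 0` and `2m - 1 > 0` means `m ≥ 1`.
  have final (b : Bool) (m : ℤ) : (if b then 0 else 1) ≤ m ↔ 0 < 2 * m + boolSign b := by
    cases b
    · simp [boolSign]
      omega
    · simp [boolSign]
  constructor
  · intro h
    induction h with
    | base h =>
      obtain ⟨_, hg, ⟨z, m⟩, ⟨rfl, hm⟩, rfl⟩ := h
      obtain ⟨g, hgr, hgs, rfl⟩ := (mem_signedLetters hP).1 hg
      refine ⟨g, [], .singleton hgr, hgs, by simp, ?_⟩
      simpa [wordWeight, hgs] using (final _ _).1 hm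
    | @step s s' a b _ ha _ ih =>
      obtain ⟨g', l, hl, hgs', hprod, hpos⟩ := ih
      by_cases hss : s.1 ≠ s'.1
      · rw [weightStep, if_pos hss] at ha
        obtain ⟨_, hg, _, rfl, rfl⟩ := ha
        obtain ⟨g, hgr, hgs, rfl⟩ := (mem_signedLetters hP).1 hg
        refine ⟨g, ⟨s'.1, g'⟩ :: l, IsReducedWord.cons_cons.2 ⟨hgr, hss, hl⟩, hgs, ?_, ?_⟩
        · rw [wordProd_cons, ← hprod]
          simp
        · have := half s.2 _ _ hss
          simp only [wordWeight, hgs, Prod.snd_mul, toAdd_mul, toAdd_one, toAdd_ofAdd] at *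
          omega
      · rw [weightStep, if_neg hss] at ha
        exact ha.elim
  · rintro ⟨g, l, hl, hgs, hprod, hpos⟩
    induction l generalizing s h g with
    | nil =>
      obtain ⟨x, m⟩ := h
      refine .base ⟨(of s.1 g, 1), (mem_signedLetters hP).2 ⟨g, hl.head, hgs, rfl⟩, (1, m),
        ⟨rfl, (final _ _).2 (by simpa [wordWeight, hgs] using hpos)⟩, ?_⟩
      exact Prod.ext (by simpa using hprod.symm) (by simp)
    | cons y l ih =>
      obtain ⟨j, g'⟩ := y
      obtain ⟨x, m⟩ := h
      obtain ⟨hgr, hij, hl'⟩ := IsReducedWord.cons_cons.1 hl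
      obtain ⟨b, hb⟩ : ∃ b, coneSign P j g' = boolSign b := by
        rcases hs.sign_abs j g' with h | h
        · exact ⟨true, h⟩
        · exact ⟨false, h⟩
      set k := (boolSign s.2 + turnSign s.1 j) / 2 with hk
      have hhalf : 2 * k = boolSign s.2 + turnSign s.1 j := half s.2 _ _ hij
      -- The tail's central coordinate is raised by `k` to offset the `-k` emitted by the
      -- transition.
      have := ih (j, b) (wordProd φ (⟨j, g'⟩ :: l), m * ofAdd k) g' hl' hb rfl (by
        simp only [wordWeight, hgs, toAdd_mul, toAdd_ofAdd] at *
        omega)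
      have hstep : ((of s.1 g, ofAdd (-k)) : Monoid.PushoutI φ × Multiplicative ℤ) ∈
          weightStep φ P s (j, b) := by
        rw [weightStep, if_pos hij]
        exact ⟨(of s.1 g, 1), (mem_signedLetters hP).2 ⟨g, hgr, hgs, rfl⟩, _, rfl, by simp [hk]⟩
      convert! LinearSolution.step (Set.mem_univ _) hstep this using 1
      refine Prod.ext ?_ ?_
      · simpa using hprod
      · simp [mul_comm m]

theorem isRational_weightCone [LinearOrder ι] [Finite ι] {P : ∀ i, Set (G i)}
    (hP : ∀ i, IsRelPositiveCone (P i) (φ i).range) (hPr : ∀ i, IsRational (P i))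
    {Q : Set C} (hQ : IsPositiveCone Q) (hQr : IsRational Q) :
    IsRational (weightCone φ turnSign (coneSign P) Q) := by
  have hsol : ∀ s, IsRational
      {h | LinearSolution Set.univ (weightStep φ P) (weightFinal φ P) s h} :=
    LinearSolution.isRational
      (fun s s' => by
        unfold weightStep
        split_ifs
        · exact (isRational_signedLetters hPr _).mul (.singleton _)
        · exact .empty)
      (fun s => (isRational_signedLetters hPr _).mul (isRational_central_ge _ _))
  let f : C →* Monoid.PushoutI φ × Multiplicative ℤ := (MonoidHom.inl _ _).comp (base φ)
  have hC := (hQ.isRational_univ hQr).image f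
  -- The three pieces are the nonempty reduced words, `C` at levels `m ≥ 1`, and `Q` at level 0.
  convert! ((hC.mul (IsRational.iUnion hsol)).union
    (hC.mul (isRational_central_ge (Monoid.PushoutI φ) 1))).union (hQr.image f) using 1
  ext ⟨x, m⟩
  constructor
  · rintro ⟨c, l, hl, rfl, h⟩
    rcases h with h | ⟨rfl, hm, hc⟩
    · left
      rcases l with _ | ⟨⟨i, g⟩, l⟩
      · refine .inr ⟨f c, ⟨c, Set.mem_univ _, rfl⟩, (1, m), ⟨rfl, ?_⟩, by simp [f]⟩
        simp only [wordWeight] at h ⊢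
        omega
      · obtain ⟨b, hb⟩ : ∃ b, coneSign P i g = boolSign b := by
          rcases (isSignSystem hP).sign_abs i g with h | h
          · exact ⟨true, h⟩
          · exact ⟨false, h⟩
        exact .inl ⟨f c, ⟨c, Set.mem_univ _, rfl⟩, (wordProd φ (⟨i, g⟩ :: l), m),
          Set.mem_iUnion.2 ⟨(i, b), (linearSolution_weight_iff hP _ _).2 ⟨g, l, hl, hb, rfl, h⟩⟩,
          by simp [f]⟩
    · refine .inr ⟨c, hc, ?_⟩
      exact Prod.ext (by simp [f]) hm.symm
  · rintro ((⟨_, ⟨c, -, rfl⟩, ⟨y, k⟩, hy, h⟩ | ⟨_, ⟨c, -, rfl⟩, ⟨_, k⟩, ⟨rfl, hk⟩, h⟩) | ⟨c, hc, h⟩)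
    · obtain ⟨s, hy⟩ := Set.mem_iUnion.1 hy
      obtain ⟨g, l, hl, -, rfl, hpos⟩ := (linearSolution_weight_iff hP _ _).1 hy
      obtain ⟨rfl, rfl⟩ := Prod.ext_iff.1 h
      exact ⟨c, _, hl, by simp [f], .inl (by simpa [f] using hpos)⟩
    · obtain ⟨rfl, rfl⟩ := Prod.ext_iff.1 h
      refine ⟨c, [], .nil, by simp [f], .inl ?_⟩
      simp [f, wordWeight] at hk ⊢
      omega
    · obtain ⟨rfl, rfl⟩ := Prod.ext_iff.1 h
      exact ⟨c, [], .nil, by simp [f], .inr ⟨rfl, by simp [f], hc⟩⟩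

end RegularOrder

open RegularOrder in
/-- The groups `G i` contain the common subgroup `C` through the injective homomorphisms `φ i`, and
`Monoid.PushoutI φ` is the free product of the `G i` amalgamated over `C`. -/
theorem mainTheorem7 (n : ℕ) (G : Fin n → Type*) [∀ i, Group (G i)]
    (C : Type*) [Group C] (φ : ∀ i, C →* G i)
    (hφ : ∀ i, Function.Injective (φ i))
    (hfg : ∀ i, Group.FG (G i))
    (hG : ∀ i, HasRegularRelPositiveCone (φ i).range)
    (hC : HasRegularPositiveCone C) :
    HasRegularLeftOrder (Monoid.PushoutI φ × Multiplicative ℤ) := by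
  choose P hP hPr using hG
  obtain ⟨Q, hQ, hQr⟩ := hC
  exact ((isSignSystem hP).isPositiveCone_weightCone hφ hQ).hasRegularLeftOrder
    (isRational_weightCone hP (fun i => (hPr i).isRational) hQ hQr.isRational)
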